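/- Fix a finite set $I$ of input positions. A quantum query algorithm with $T$ queries to an input $x\in\{0,1\}^I$ is a sequence $U_T O U_{T-1}O\cdots O U_1 O U_0$ applied to a fixed initial basis state. The $U_i$ are unitaries, independent of $x$, on a space with basis states $|j,b,z\rangle$ ($j\in I$, $b$ a bit, $z$ finitely many workspace bits), and $O$ is the query gate $|j,b,z\rangle\mapsto|j,b\oplus x_j,z\rangle$. It computes $f:\{0,1\}^I\to\{0,1\}$ exactly if, for every $x$, measuring a designated output qubit of the final state gives $f(x)$ with probability $1$. The exact quantum query complexity $Q_E(f)$ is the least $T$ for which such an algorithm exists. A directed graph on $n$ vertices (no loops) is given by $n(n-1)$ bits, one for each ordered pair of distinct vertices; an undirected graph is given by $\binom n2$ bits, one for each unordered pair of distinct vertices. A nontrivial monotone graph property on $n$ vertices is a non-constant Boolean function $P$ of these bits that is invariant under permutations of the vertices and monotone (adding edges cannot destroy the property). **Theorem.** 1. There is an absolute constant $c>0$ such that $Q_E(P)\ge c\,n^2$ for every $n$ and every nontrivial monotone property $P$ of directed graphs on $n$ vertices. 2. For every $n>2$, the property $P$ "the directed graph contains more than $n(n-1)/2$ edges" is a nontrivial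 monotone graph property, and $Q_E(P)<n(n-1)$. 3. The same holds for undirected graphs: there is an absolute constant $c>0$ such that $Q_E(P)\ge c\,n^2$ for every $n$ and every nontrivial monotone property $P$ of undirected graphs on $n$ vertices; and for every $n>2$, the property $P$ "the graph contains more than $\frac12\binom n2$ edges" is a nontrivial monotone graph property with $Q_E(P)<\binom n2$. (So the analogue of the evasiveness conjecture for exact quantum algorithms fails, but it holds up to a constant factor.) -/

import Mathlib

open scoped Matrix ENNReal

/-- Labels of the computational basis states `|j, b, z⟩`: an index register `j ∈ I` (the positions of
the black-box input), a target qubit `b`, and a workspace `z` of `m` further qubits. -/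
abbrev BasisLabel (I : Type) (m : ℕ) : Type := I × Bool × (Fin m → Bool)

/-- The query gate `|j, b, z⟩ ↦ |j, b ⊕ x_j, z⟩` of the input `x`, extended linearly to vectors of
amplitudes. As the gate is an involution on the basis states, the amplitude of `|j, b, z⟩` after the
gate is the amplitude of `|j, b ⊕ x_j, z⟩` before it. -/
def queryGate {I : Type} {m : ℕ} (x : I → Bool) (ψ : BasisLabel I m → ℂ) : BasisLabel I m → ℂ :=
  fun v => ψ (v.1, xor v.2.1 (x v.1), v.2.2)

/-- A quantum query algorithm `U_T O U_{T-1} O ⋯ O U_1 O U_0` with `T` queries to an input from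
`{0,1}^I`. The unitaries do not depend on the input. The initial state is the fixed basis state
`|start, 0, 0⋯0⟩`; the result is read off the workspace qubit `out`. -/
structure QueryAlgorithm (I : Type) [Fintype I] [DecidableEq I] (T : ℕ) where
  /-- number of workspace qubits -/
  m : ℕ
  /-- initial content of the index register -/
  start : I
  /-- the output qubit -/
  out : Fin m
  /-- the input-independent unitaries `U_0, …, U_T` -/
  U : Fin (T + 1) → Matrix.unitaryGroup (BasisLabel I m) ℂ

namespace QueryAlgorithm

/-- The state `U_t O U_{t-1} O ⋯ O U_0 |start, 0, 0⋯0⟩` on input `x`. -/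
def state {I : Type} [Fintype I] [DecidableEq I] {T : ℕ} (A : QueryAlgorithm I T) (x : I → Bool)
    (t : Fin (T + 1)) : BasisLabel I A.m → ℂ :=
  Fin.induction (motive := fun _ => BasisLabel I A.m → ℂ)
    ((A.U 0).1 *ᵥ Pi.single (A.start, false, fun _ => false) 1)
    (fun s ψ => (A.U s.succ).1 *ᵥ queryGate x ψ) t

/-- The probability that measuring the output qubit of the final state on input `x` gives `1`. -/
noncomputable def acceptProb {I : Type} [Fintype I] [DecidableEq I] {T : ℕ}
    (A : QueryAlgorithm I T) (x : I → Bool) : ℝ :=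
  ∑ v : BasisLabel I A.m, if v.2.2 A.out = true then ‖A.state x (Fin.last T) v‖ ^ 2 else 0

/-- The algorithm computes `f` exactly: on every input it outputs `f x` with certainty. -/
def ComputesExactly {I : Type} [Fintype I] [DecidableEq I] {T : ℕ}
    (A : QueryAlgorithm I T) (f : (I → Bool) → Bool) : Prop :=
  ∀ x : I → Bool, A.acceptProb x = if f x = true then 1 else 0

end QueryAlgorithm

/-- The exact quantum query complexity `Q_E(f)`: the least `T` such that some quantum algorithm with
`T` queries computes `f` exactly (`⊤` if there were no such algorithm). -/
noncomputable def exactQuantumQueryComplexity {I : Type} [Fintype I] [DecidableEq I]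
    (f : (I → Bool) → Bool) : ℕ∞ :=
  sInf {q : ℕ∞ | ∃ T : ℕ, q = T ∧ ∃ A : QueryAlgorithm I T, A.ComputesExactly f}

/-- The `n(n-1)` possible edges `i → j`, `i ≠ j`, of a directed graph on the vertices `Fin n`.
A directed graph is given by its edge bits `DiEdge n → Bool`. -/
abbrev DiEdge (n : ℕ) : Type := {e : Fin n × Fin n // e.1 ≠ e.2}

/-- Relabelling of directed edges by a permutation of the vertices. -/
def DiEdge.map {n : ℕ} (σ : Equiv.Perm (Fin n)) (e : DiEdge n) : DiEdge n :=
  ⟨(σ e.1.1, σ e.1.2), fun h => e.2 (σ.injective h)⟩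

/-- Nontrivial monotone properties of directed graphs on `n` vertices: invariant under permutations
of the vertices, monotone (adding edges cannot destroy the property), and not constant. -/
structure IsMonotoneDigraphProperty {n : ℕ} (P : (DiEdge n → Bool) → Bool) : Prop where
  invariant : ∀ (σ : Equiv.Perm (Fin n)) (x : DiEdge n → Bool), P (x ∘ DiEdge.map σ) = P x
  monotone : Monotone P
  nonconstant : ∃ x y : DiEdge n → Bool, P x ≠ P y

/-- The property "the directed graph contains more than `n(n-1)/2` edges". -/
def majorityDigraph (n : ℕ) (x : DiEdge n → Bool) : Bool :=
  decide (n * (n - 1) < 2 * (Finset.univ.filter fun e => x e = true).card)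

/-- The `n(n-1)/2` possible edges `{i, j}`, `i ≠ j`, of an undirected graph on the vertices `Fin n`.
An undirected graph is given by its edge bits `UEdge n → Bool`. -/
abbrev UEdge (n : ℕ) : Type := {e : Sym2 (Fin n) // ¬ e.IsDiag}

/-- Relabelling of undirected edges by a permutation of the vertices. -/
def UEdge.map {n : ℕ} (σ : Equiv.Perm (Fin n)) (e : UEdge n) : UEdge n :=
  ⟨Sym2.map σ e.1, fun h => e.2 ((Sym2.isDiag_map σ.injective).1 h)⟩

/-- Nontrivial monotone properties of undirected graphs on `n` vertices. -/
structure IsMonotoneGraphProperty {n : ℕ} (P : (UEdge n → Bool) → Bool) : Prop where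
  invariant : ∀ (σ : Equiv.Perm (Fin n)) (x : UEdge n → Bool), P (x ∘ UEdge.map σ) = P x
  monotone : Monotone P
  nonconstant : ∃ x y : UEdge n → Bool, P x ≠ P y

/-- The property "the undirected graph contains more than half of the `n(n-1)/2` possible edges". -/
def majorityGraph (n : ℕ) (x : UEdge n → Bool) : Bool :=
  decide (n.choose 2 < 2 * (Finset.univ.filter fun e => x e = true).card)

/-! Lower bound: the polynomial method. After `T` queries every amplitude is a polynomial of degree
at most `T` in the input bits, so the acceptance probability has degree at most `2T`. If a subcube
of dimension `d` contains an odd number of accepted points, their count signed by parity is nonzero,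
which forces `d ≤ 2T` (`card_le_of_odd`). Oddness comes from a group action in the style of Rivest
and Vuillemin: under a 2-group acting transitively on the coordinates only the two constant inputs
are fixed, and exactly one of them is accepted (`odd_card_of_translation_invariant`). A nontrivial
monotone graph property on at least `2^(k+1)` vertices restricts to such a cube of dimension `4^k`
(`SimpleGraph.IsMonotoneProperty.hasInvariantRestriction`), whence `n² < 32T`.

Upper bound: one query determines `x_i ⊕ x_j` exactly. To find a majority, compare bits of equal
weight in pairs: unequal bits cancel, equal bits merge into one of double weight. A query is saved
once a pair cancels, or once a lone bit is left among heavier ones, where it only breaks ties.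
Nothing is saved only if all bits merge into one, and then their number is a power of two; `n(n-1)`
and `n.choose 2` are not, for `n > 2`. -/

/-! ### The polynomial method on subcubes -/

/-- The function `g` on the Boolean cube is given by a polynomial of total degree at most `d`. -/
def HasCubeDegreeLE {J : Type} (d : ℕ) (g : (J → Bool) → ℂ) : Prop :=
  ∃ p : MvPolynomial J ℂ, p.totalDegree ≤ d ∧
    ∀ y, g y = MvPolynomial.eval (fun j => if y j = true then (1 : ℂ) else 0) p

namespace HasCubeDegreeLE

variable {J : Type}

theorem const (c : ℂ) : HasCubeDegreeLE 0 (fun _ : J → Bool => c) :=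
  ⟨MvPolynomial.C c, by simp, by simp⟩

theorem bit (j : J) : HasCubeDegreeLE 1 (fun y : J → Bool => if y j = true then (1 : ℂ) else 0) :=
  ⟨MvPolynomial.X j, by simp, by simp⟩

theorem mono {d e : ℕ} {g : (J → Bool) → ℂ} (h : HasCubeDegreeLE d g) (hde : d ≤ e) :
    HasCubeDegreeLE e g := by
  obtain ⟨p, hp, hg⟩ := h
  exact ⟨p, hp.trans hde, hg⟩

theorem add {d : ℕ} {g h : (J → Bool) → ℂ} (hg : HasCubeDegreeLE d g) (hh : HasCubeDegreeLE d h) :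
    HasCubeDegreeLE d (fun y => g y + h y) := by
  obtain ⟨p, hp, hg⟩ := hg
  obtain ⟨q, hq, hh⟩ := hh
  exact ⟨p + q, (MvPolynomial.totalDegree_add p q).trans (max_le hp hq), fun y => by
    simp only [hg, hh, map_add]⟩

theorem mul {d e : ℕ} {g h : (J → Bool) → ℂ} (hg : HasCubeDegreeLE d g)
    (hh : HasCubeDegreeLE e h) : HasCubeDegreeLE (d + e) (fun y => g y * h y) := by
  obtain ⟨p, hp, hg⟩ := hg
  obtain ⟨q, hq, hh⟩ := hh
  exact ⟨p * q, (MvPolynomial.totalDegree_mul p q).trans (add_le_add hp hq), fun y => by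
    simp only [hg, hh, map_mul]⟩

theorem sum {ι : Type} (s : Finset ι) {d : ℕ} {g : ι → (J → Bool) → ℂ}
    (hg : ∀ i ∈ s, HasCubeDegreeLE d (g i)) : HasCubeDegreeLE d (fun y => ∑ i ∈ s, g i y) := by
  classical
  induction s using Finset.induction_on with
  | empty => simpa using (const (J := J) 0).mono (Nat.zero_le d)
  | insert a s ha ih =>
    simp only [Finset.sum_insert ha]
    exact (hg a (Finset.mem_insert_self a s)).add
      (ih fun i hi => hg i (Finset.mem_insert_of_mem hi))

/-- Points of the cube have real coordinates, so conjugating the coefficients conjugates the value.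
-/
theorem star {d : ℕ} {g : (J → Bool) → ℂ} (hg : HasCubeDegreeLE d g) :
    HasCubeDegreeLE d (fun y => starRingEnd ℂ (g y)) := by
  obtain ⟨p, hp, hg⟩ := hg
  refine ⟨MvPolynomial.map (starRingEnd ℂ) p, ?_, fun y => ?_⟩
  · refine le_trans ?_ hp
    exact Finset.sup_mono (MvPolynomial.support_map_subset _ _)
  · simp only [hg]
    rw [MvPolynomial.eval_map, ← MvPolynomial.eval₂_id, MvPolynomial.eval₂_comp_left]
    congr 1
    ext j
    dsimp only [Function.comp_apply]
    split_ifs <;> simp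

/-- A polynomial whose degree is less than the dimension of the cube is orthogonal to parity. -/
theorem sum_signed_eq_zero [Fintype J] [DecidableEq J] {d : ℕ} {g : (J → Bool) → ℂ}
    (hg : HasCubeDegreeLE d g) (hd : d < Fintype.card J) :
    ∑ y : J → Bool, (∏ j, if y j = true then (-1 : ℂ) else 1) * g y = 0 := by
  obtain ⟨p, hp, hg⟩ := hg
  simp only [hg, MvPolynomial.eval_eq', Finset.mul_sum]
  rw [Finset.sum_comm]
  refine Finset.sum_eq_zero fun m hm => ?_
  have hm' : m.support.card < Fintype.card J := by
    refine lt_of_le_of_lt ?_ hd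
    refine le_trans ?_ ((MvPolynomial.le_totalDegree hm).trans hp)
    rw [Finsupp.sum, Finset.card_eq_sum_ones]
    exact Finset.sum_le_sum fun i hi => Nat.one_le_iff_ne_zero.2 (Finsupp.mem_support_iff.1 hi)
  -- A monomial of too small degree misses a variable `i`; its signed sum over the cube is a product
  -- over the coordinates whose `i`-th factor is `-1 + 1`.
  obtain ⟨i, hi⟩ : ∃ i, i ∉ m.support := by
    by_contra! h
    rw [Finset.eq_univ_iff_forall.2 h] at hm'
    exact lt_irrefl _ hm'
  have hi0 : m i = 0 := by simpa using hi
  have key : ∀ y : J → Bool, (∏ j, if y j = true then (-1 : ℂ) else 1) *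
      (p.coeff m * ∏ j, (if y j = true then (1 : ℂ) else 0) ^ m j) =
      p.coeff m * ∏ j, ((if y j = true then (-1 : ℂ) else 1) *
        (if y j = true then (1 : ℂ) else 0) ^ m j) := fun y => by
    rw [Finset.prod_mul_distrib]; ring
  simp only [key]
  rw [← Finset.mul_sum, ← Fintype.piFinset_univ, ← Finset.prod_univ_sum (fun _ : J => (Finset.univ : Finset Bool)) (fun j b => (if b = true then (-1 : ℂ) else 1) *
        (if b = true then (1 : ℂ) else 0) ^ m j)]
  rw [Finset.prod_eq_zero (Finset.mem_univ i), mul_zero]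
  simp [hi0]

end HasCubeDegreeLE

/-- The bits of `X y` are constants or coordinates of `y`. -/
def IsSubcube {I J : Type} (X : (J → Bool) → I → Bool) : Prop :=
  ∀ i, (∃ c, ∀ y, X y i = c) ∨ ∃ j, ∀ y, X y i = y j

theorem IsSubcube.hasCubeDegreeLE {I J : Type} {X : (J → Bool) → I → Bool} (hX : IsSubcube X) (i : I) :
    HasCubeDegreeLE 1 (fun y => if X y i = true then (1 : ℂ) else 0) := by
  rcases hX i with ⟨c, hc⟩ | ⟨j, hj⟩
  · simp only [hc]
    exact (HasCubeDegreeLE.const _).mono zero_le_one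
  · simp only [hj]
    exact HasCubeDegreeLE.bit j

namespace QueryAlgorithm

variable {I J : Type} [Fintype I] [DecidableEq I] {T : ℕ}

theorem state_zero (A : QueryAlgorithm I T) (x : I → Bool) :
    A.state x 0 = (A.U 0).1 *ᵥ Pi.single (A.start, false, fun _ => false) 1 := rfl

theorem state_succ (A : QueryAlgorithm I T) (x : I → Bool) (t : Fin T) :
    A.state x t.succ = (A.U t.succ).1 *ᵥ queryGate x (A.state x t.castSucc) := by
  rw [state, Fin.induction_succ]; rfl

theorem hasCubeDegreeLE_state (A : QueryAlgorithm I T) {X : (J → Bool) → I → Bool}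
    (hX : IsSubcube X) (t : Fin (T + 1)) (v : BasisLabel I A.m) :
    HasCubeDegreeLE (t : ℕ) (fun y => A.state (X y) t v) := by
  induction t using Fin.induction generalizing v with
  | zero =>
    simp only [state_zero]
    exact HasCubeDegreeLE.const _
  | succ t ih =>
    simp only [state_succ, Matrix.mulVec, dotProduct]
    refine HasCubeDegreeLE.sum _ fun w _ => ?_
    have hq : HasCubeDegreeLE ((t.succ : Fin (T + 1)) : ℕ)
        (fun y => queryGate (X y) (A.state (X y) t.castSucc) w) := by
      -- With `b` the queried bit, the amplitude after the gate is `b` times the flipped amplitude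
      -- plus `1 - b` times the unflipped one, so a query raises the degree by one.
      have h1 := (hX.hasCubeDegreeLE w.1).mul (ih (w.1, !w.2.1, w.2.2))
      have h2 := (((hX.hasCubeDegreeLE w.1).mul (HasCubeDegreeLE.const (-1))).add
        ((HasCubeDegreeLE.const 1).mono zero_le_one)).mul (ih (w.1, w.2.1, w.2.2))
      have h3 := h1.add h2
      have e : 1 + (t.castSucc : ℕ) = (t.succ : Fin (T + 1)) := by simp [add_comm]
      rw [e] at h3
      convert h3 using 2 with y
      rw [queryGate]
      cases hb : X y w.1 <;> simp
    simpa using (HasCubeDegreeLE.const _).mul hq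

theorem hasCubeDegreeLE_acceptProb (A : QueryAlgorithm I T) {X : (J → Bool) → I → Bool}
    (hX : IsSubcube X) : HasCubeDegreeLE (2 * T) (fun y => (A.acceptProb (X y) : ℂ)) := by
  simp only [acceptProb, Complex.ofReal_sum]
  refine HasCubeDegreeLE.sum _ fun v _ => ?_
  have h := A.hasCubeDegreeLE_state hX (Fin.last T) v
  split_ifs
  · have := h.mul h.star
    rw [Fin.val_last, ← two_mul] at this
    convert this using 2 with y
    rw [Complex.mul_conj, Complex.normSq_eq_norm_sq]
  · simpa using (HasCubeDegreeLE.const (J := J) 0).mono (Nat.zero_le (2 * T))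

/-- If `f` has odd weight on a subcube of dimension `|J|`, then exact computation of `f` takes at
least `|J| / 2` queries. -/
theorem card_le_of_odd [Fintype J] [DecidableEq J] {A : QueryAlgorithm I T}
    {f : (I → Bool) → Bool} (hA : A.ComputesExactly f) {X : (J → Bool) → I → Bool}
    (hX : IsSubcube X)
    (hodd : Odd (Finset.univ.filter fun y : J → Bool => f (X y) = true).card) :
    Fintype.card J ≤ 2 * T := by
  by_contra! hlt
  have h0 := (A.hasCubeDegreeLE_acceptProb hX).sum_signed_eq_zero hlt
  have h1 : ((∑ y : J → Bool, (∏ j, if y j = true then (-1 : ℤ) else 1) *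
      (if f (X y) = true then 1 else 0) : ℤ) : ℂ) = 0 := by
    rw [← h0]
    push_cast
    refine Finset.sum_congr rfl fun y _ => ?_
    rw [hA (X y)]
    congr 1
    split_ifs <;> simp
  rw [Int.cast_eq_zero] at h1
  -- Modulo 2 the signs disappear and the signed sum becomes the number of accepted points.
  have h2 := congrArg (Int.cast : ℤ → ZMod 2) h1
  push_cast at h2
  have h3 : ∀ y : J → Bool, (∏ j, if y j = true then (-1 : ZMod 2) else 1) = 1 := fun y =>
    Finset.prod_eq_one fun j _ => by split_ifs <;> decide
  simp only [h3, one_mul, Finset.sum_boole] at h2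
  rw [ZMod.natCast_eq_zero_iff_even] at h2
  exact (Nat.not_even_iff_odd.2 hodd) h2

end QueryAlgorithm

/-! ### Odd weight from a transitive 2-group -/

/-- A Boolean function on a cube that is invariant under a transitive `2`-group of permutations of
the coordinates and differs at the two constant inputs has odd weight. -/
theorem odd_card_of_translation_invariant {J : Type} [AddGroup J] [Fintype J] [DecidableEq J]
    {m : ℕ} (hJ : Fintype.card J = 2 ^ m) (g : (J → Bool) → Prop) [DecidablePred g]
    (hinv : ∀ c y, g (fun j => y (j + c)) ↔ g y) (h0 : ¬ g fun _ => false)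
    (h1 : g fun _ => true) : Odd (Finset.univ.filter fun y : J → Bool => g y).card := by
  let act : MulAction (Multiplicative J) {y : J → Bool // g y} :=
    { smul := fun c y => ⟨fun j => y.1 (j + c.toAdd), (hinv _ _).2 y.2⟩
      one_smul := fun y => Subtype.ext (funext fun j => congrArg y.1 (add_zero j))
      mul_smul := fun c d y =>
        Subtype.ext (funext fun j => congrArg y.1 (add_assoc j c.toAdd d.toAdd).symm) }
  have hG : IsPGroup 2 (Multiplicative J) :=
    IsPGroup.of_card (n := m) (by rw [Nat.card_eq_fintype_card, Fintype.card_multiplicative, hJ])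
  have key := hG.card_modEq_card_fixedPoints {y : J → Bool // g y}
  -- Translations are transitive, so a fixed input is constant; all-false is rejected, which leaves
  -- one fixed point.
  have hfix : MulAction.fixedPoints (Multiplicative J) {y : J → Bool // g y} =
      {⟨fun _ => true, h1⟩} := by
    ext ⟨y, hy⟩
    rw [MulAction.mem_fixedPoints, Set.mem_singleton_iff]
    refine ⟨fun h => ?_, fun h c => ?_⟩
    · have hc : ∀ j, y j = y 0 := fun j => by
        have := congrFun (congrArg Subtype.val (h (Multiplicative.ofAdd j))) 0
        exact (congrArg y (zero_add j).symm).trans this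
      cases h00 : y 0
      · exact absurd ((funext fun j => (hc j).trans h00 : y = fun _ => false) ▸ hy) h0
      · exact Subtype.ext (funext fun j => (hc j).trans h00)
    · rw [h]; rfl
  rw [hfix, Nat.card_eq_fintype_card, Fintype.card_subtype] at key
  simp only [Nat.card_eq_fintype_card, Fintype.card_unique] at key
  rw [Nat.odd_iff]
  exact key

/-! ### Invariant restrictions of monotone graph properties -/

/-- Nontrivial monotone graph properties, as predicates on simple graphs. -/
structure SimpleGraph.IsMonotoneProperty {V : Type} (P : SimpleGraph V → Prop) : Prop where
  mono : ∀ G H, G ≤ H → P G → P H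
  inv : ∀ (σ : Equiv.Perm V) G, P (G.comap σ) ↔ P G
  bot : ¬ P ⊥
  top : P ⊤

/-- The property `P` has a restriction to a cube of graphs, with coordinates indexed by
`(ℤ/2)^k × (ℤ/2)^k`, that is invariant under translations of the coordinates and differs at the two
constant inputs. -/
def SimpleGraph.HasInvariantRestriction {V : Type} (k : ℕ) (P : SimpleGraph V → Prop) : Prop :=
  ∃ Gr : ((Fin k → ZMod 2) × (Fin k → ZMod 2) → Bool) → SimpleGraph V,
    (∀ a b, (∃ c : Prop, ∀ y, (Gr y).Adj a b ↔ c) ∨ ∃ j, ∀ y, (Gr y).Adj a b ↔ y j = true) ∧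
    (∀ c y, P (Gr fun j => y (j + c)) ↔ P (Gr y)) ∧
    ¬ P (Gr fun _ => false) ∧ P (Gr fun _ => true)

namespace SimpleGraph

variable {V W : Type} {k : ℕ}

/-- Used to pass to fewer vertices: `E` fills every vertex pair with a constant or with an edge of
the smaller graph, so coordinates remain coordinates. -/
theorem HasInvariantRestriction.of_comp {P : SimpleGraph V → Prop}
    (E : SimpleGraph W → SimpleGraph V)
    (hE : ∀ a b, (∃ c : Prop, ∀ G, (E G).Adj a b ↔ c) ∨
      ∃ a' b', ∀ G, (E G).Adj a b ↔ G.Adj a' b')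
    (h : HasInvariantRestriction k fun G => P (E G)) : HasInvariantRestriction k P := by
  obtain ⟨Gr, h1, h2, h3, h4⟩ := h
  refine ⟨fun y => E (Gr y), fun a b => ?_, h2, h3, h4⟩
  rcases hE a b with ⟨c, hc⟩ | ⟨a', b', hab⟩
  · exact Or.inl ⟨c, fun y => hc _⟩
  · simpa only [hab] using h1 a' b'

theorem IsMonotoneProperty.comap {P : SimpleGraph V → Prop} (hP : IsMonotoneProperty P)
    (e : V ≃ W) : IsMonotoneProperty fun G : SimpleGraph W => P (G.comap e) where
  mono G H hGH := hP.mono _ _ fun _ _ h => hGH h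
  inv σ G := by
    rw [← hP.inv ((e.trans σ).trans e.symm) (G.comap e)]
    have : (G.comap σ).comap e = (G.comap e).comap ((e.trans σ).trans e.symm) := by
      ext a b; simp
    rw [this]
  bot := by
    have : (⊥ : SimpleGraph W).comap e = ⊥ := by ext a b; simp
    rw [this]; exact hP.bot
  top := by
    have : (⊤ : SimpleGraph W).comap e = ⊤ := by ext a b; simp
    rw [this]; exact hP.top

/-- Vertices of `(ℤ/2)^(k+1)` are adjacent if they agree on all coordinates from `i` on: a disjoint
union of cliques of size `2^i`. -/
def cubeCliques (k i : ℕ) : SimpleGraph (Fin (k + 1) → ZMod 2) where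
  Adj u w := u ≠ w ∧ ∀ j : Fin (k + 1), i ≤ j → u j = w j
  symm := ⟨fun _ _ h => ⟨h.1.symm, fun j hj => (h.2 j hj).symm⟩⟩
  loopless := ⟨fun _ h => h.1 rfl⟩

/-- The cliques of `cubeCliques k i`, with edges given by `y` between the two halves of the vertex
set determined by the coordinate `i`. -/
def cubeCliquesJoin {k : ℕ} (i : Fin (k + 1)) (y : (Fin k → ZMod 2) × (Fin k → ZMod 2) → Bool) :
    SimpleGraph (Fin (k + 1) → ZMod 2) where
  Adj u w := (cubeCliques k i).Adj u w ∨
    (u i = 0 ∧ w i = 1 ∧ y (fun j => u (i.succAbove j), fun j => w (i.succAbove j)) = true) ∨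
    (u i = 1 ∧ w i = 0 ∧ y (fun j => w (i.succAbove j), fun j => u (i.succAbove j)) = true)
  symm := ⟨fun u w h => by
    rcases h with h | ⟨h1, h2, h3⟩ | ⟨h1, h2, h3⟩
    · exact Or.inl h.symm
    · exact Or.inr (Or.inr ⟨h2, h1, h3⟩)
    · exact Or.inr (Or.inl ⟨h2, h1, h3⟩)⟩
  loopless := ⟨fun u h => by
    rcases h with h | ⟨h1, h2, -⟩ | ⟨h1, h2, -⟩
    · exact h.ne rfl
    · exact zero_ne_one (h1.symm.trans h2)
    · exact zero_ne_one (h2.symm.trans h1)⟩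

/-- Translation by `c.1` in the half where the coordinate `i` is `0` and by `c.2` in the other. -/
def halfShift {k : ℕ} (i : Fin (k + 1)) (c : (Fin k → ZMod 2) × (Fin k → ZMod 2))
    (u : Fin (k + 1) → ZMod 2) : Fin (k + 1) → ZMod 2 :=
  u + i.insertNth (α := fun _ => ZMod 2) 0 (if u i = 0 then c.1 else c.2)

theorem halfShift_same (i : Fin (k + 1)) (c : (Fin k → ZMod 2) × (Fin k → ZMod 2))
    (u : Fin (k + 1) → ZMod 2) : halfShift i c u i = u i := by
  simp [halfShift]

theorem halfShift_succAbove (i : Fin (k + 1)) (c : (Fin k → ZMod 2) × (Fin k → ZMod 2))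
    (u : Fin (k + 1) → ZMod 2) (j : Fin k) :
    halfShift i c u (i.succAbove j) = u (i.succAbove j) + (if u i = 0 then c.1 else c.2) j := by
  simp [halfShift]

theorem halfShift_involutive (i : Fin (k + 1)) (c : (Fin k → ZMod 2) × (Fin k → ZMod 2)) :
    Function.Involutive (halfShift i c) := by
  intro u
  rw [halfShift, halfShift_same, halfShift, add_assoc, CharTwo.add_self_eq_zero, add_zero]

/-- Clique-adjacent vertices agree at `i`, hence lie in one half and move by the same vector, so the
cliques survive. A pair across the halves has its coordinate shifted by `c`. -/
theorem cubeCliquesJoin_comap (i : Fin (k + 1)) (c : (Fin k → ZMod 2) × (Fin k → ZMod 2))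
    (y : (Fin k → ZMod 2) × (Fin k → ZMod 2) → Bool) :
    (cubeCliquesJoin i y).comap (halfShift_involutive i c).toPerm =
      cubeCliquesJoin i fun j => y (j + c) := by
  ext u w
  simp only [comap_adj, Function.Involutive.coe_toPerm, cubeCliquesJoin, halfShift_same,
    halfShift_succAbove]
  have h1 : (cubeCliques k i).Adj (halfShift i c u) (halfShift i c w) ↔
      (cubeCliques k i).Adj u w := by
    simp only [cubeCliques, ne_eq, (halfShift_involutive i c).injective.eq_iff]
    refine and_congr_right fun _ => ⟨fun h j hj => ?_, fun h j hj => ?_⟩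
    · have hi := h i le_rfl
      rw [halfShift_same, halfShift_same] at hi
      have := h j hj
      simpa [halfShift, hi] using this
    · simp [halfShift, h i le_rfl, h j hj]
  refine or_congr h1 (or_congr ?_ ?_)
  · refine and_congr_right fun hu => and_congr_right fun hw => ?_
    simp only [hu, hw, if_true, one_ne_zero, if_false]
    rfl
  · refine and_congr_right fun hu => and_congr_right fun hw => ?_
    simp only [hu, hw, if_true, one_ne_zero, if_false]
    rfl

theorem cubeCliquesJoin_adj (i : Fin (k + 1)) (u w : Fin (k + 1) → ZMod 2) :
    (∃ c : Prop, ∀ y, (cubeCliquesJoin i y).Adj u w ↔ c) ∨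
      ∃ j, ∀ y, (cubeCliquesJoin i y).Adj u w ↔ y j = true := by
  have h01 : ∀ a : ZMod 2, a = 0 ∨ a = 1 := by decide
  by_cases h : u i = w i
  · refine Or.inl ⟨(cubeCliques k i).Adj u w, fun y => ?_⟩
    simp only [cubeCliquesJoin, or_iff_left_iff_imp]
    rintro (⟨h1, h2, -⟩ | ⟨h1, h2, -⟩)
    · exact absurd (h1.symm.trans (h.trans h2)) zero_ne_one
    · exact absurd (h2.symm.trans (h.symm.trans h1)) zero_ne_one
  · have hn : ¬ (cubeCliques k i).Adj u w := fun h' => h (h'.2 i le_rfl)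
    right
    rcases h01 (u i) with hu | hu <;> rcases h01 (w i) with hw | hw
    · exact absurd (hu.trans hw.symm) h
    · exact ⟨_, fun y => by simp [cubeCliquesJoin, hn, hu, hw]; rfl⟩
    · exact ⟨_, fun y => by simp [cubeCliquesJoin, hn, hu, hw]; rfl⟩
    · exact absurd (hu.trans hw.symm) h

/-- Doubling the clique size leads from the empty to the complete graph, so the property switches on
between some `i` and `i + 1`. The join with no cross edges is `cubeCliques k i`; with all of them it
contains `cubeCliques k (i + 1)`. -/
theorem IsMonotoneProperty.hasInvariantRestriction_cube
    {P : SimpleGraph (Fin (k + 1) → ZMod 2) → Prop} (hP : IsMonotoneProperty P) :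
    HasInvariantRestriction k P := by
  have h0 : cubeCliques k 0 = ⊥ := by
    ext u w
    simp only [cubeCliques, bot_adj, iff_false, not_and]
    exact fun h h' => h (funext fun j => h' j (Nat.zero_le _))
  have htop : cubeCliques k (k + 1) = ⊤ := by
    ext u w
    simp only [cubeCliques, top_adj, and_iff_left_iff_imp]
    exact fun _ j hj => absurd j.2 (not_lt.2 hj)
  obtain ⟨i, hi, hi0, hi1⟩ : ∃ i, i < k + 1 ∧ ¬ P (cubeCliques k i) ∧
      P (cubeCliques k (i + 1)) := by
    by_contra! hcon
    have : ∀ i, i ≤ k + 1 → ¬ P (cubeCliques k i) := by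
      intro i
      induction i with
      | zero => rw [h0]; exact fun _ => hP.bot
      | succ i ih => exact fun hi => hcon i hi (ih (Nat.le_of_succ_le hi))
    exact this (k + 1) le_rfl (htop ▸ hP.top)
  refine ⟨cubeCliquesJoin ⟨i, hi⟩, cubeCliquesJoin_adj _, fun c y => ?_, ?_, ?_⟩
  · rw [← cubeCliquesJoin_comap, hP.inv]
  · refine fun h => hi0 (hP.mono _ _ (fun u w huw => ?_) h)
    simpa [cubeCliquesJoin] using huw
  · refine hP.mono _ _ (fun u w huw => ?_) hi1
    have h01 : ∀ a : ZMod 2, a = 0 ∨ a = 1 := by decide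
    by_cases h : u ⟨i, hi⟩ = w ⟨i, hi⟩
    · refine Or.inl ⟨huw.1, fun j hj => ?_⟩
      rcases (show i ≤ j from hj).eq_or_lt with hj | hj
      · have : j = ⟨i, hi⟩ := Fin.ext hj.symm
        rw [this, h]
      · exact huw.2 j hj
    · right
      rcases h01 (u ⟨i, hi⟩) with hu | hu <;> rcases h01 (w ⟨i, hi⟩) with hw | hw
      · exact absurd (hu.trans hw.symm) h
      · exact Or.inl ⟨hu, hw, rfl⟩
      · exact Or.inr ⟨hu, hw, rfl⟩
      · exact absurd (hu.trans hw.symm) h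

/-- Adds the vertex `v` to a graph on the other vertices, joined to all of them if `d` holds and to
none of them otherwise. -/
def extendAt (v : V) (d : Prop) (G : SimpleGraph {w // w ≠ v}) : SimpleGraph V where
  Adj a b := (d ∧ a ≠ b ∧ (a = v ∨ b = v)) ∨ ∃ (ha : a ≠ v) (hb : b ≠ v), G.Adj ⟨a, ha⟩ ⟨b, hb⟩
  symm := ⟨fun a b h => by
    rcases h with ⟨h1, h2, h3⟩ | ⟨ha, hb, h⟩
    · exact Or.inl ⟨h1, h2.symm, h3.symm⟩
    · exact Or.inr ⟨hb, ha, h.symm⟩⟩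
  loopless := ⟨fun a h => by
    rcases h with ⟨-, h, -⟩ | ⟨_, _, h⟩
    · exact h rfl
    · exact h.ne rfl⟩

theorem extendAt_adj_cases (v : V) (d : Prop) (a b : V) :
    (∃ c : Prop, ∀ G, (extendAt v d G).Adj a b ↔ c) ∨
      ∃ a' b', ∀ G, (extendAt v d G).Adj a b ↔ G.Adj a' b' := by
  by_cases ha : a = v
  · exact Or.inl ⟨d ∧ a ≠ b, fun G => by simp [extendAt, ha]⟩
  by_cases hb : b = v
  · exact Or.inl ⟨d ∧ a ≠ b, fun G => by simp [extendAt, hb]⟩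
  · exact Or.inr ⟨⟨a, ha⟩, ⟨b, hb⟩, fun G => by simp [extendAt, ha, hb]⟩

theorem IsMonotoneProperty.extendAt {P : SimpleGraph V → Prop} (hP : IsMonotoneProperty P) (v : V)
    (d : Prop) (h0 : ¬ P (extendAt v d ⊥)) (h1 : P (extendAt v d ⊤)) :
    IsMonotoneProperty fun G => P (SimpleGraph.extendAt v d G) where
  mono G H hGH := hP.mono _ _ fun a b h => by
    rcases h with h | ⟨ha, hb, h⟩
    · exact Or.inl h
    · exact Or.inr ⟨ha, hb, hGH h⟩
  inv σ G := by
    classical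
    have hv : Equiv.Perm.ofSubtype σ v = v := Equiv.Perm.ofSubtype_apply_of_not_mem σ (by simp)
    have hne : ∀ a, Equiv.Perm.ofSubtype σ a = v ↔ a = v := fun a =>
      ⟨fun h => (Equiv.Perm.ofSubtype σ).injective (h.trans hv.symm), fun h => by rw [h, hv]⟩
    have hcoe : ∀ a (ha : a ≠ v) (ha' : Equiv.Perm.ofSubtype σ a ≠ v),
        (⟨Equiv.Perm.ofSubtype σ a, ha'⟩ : {w // w ≠ v}) = σ ⟨a, ha⟩ := fun a ha ha' =>
      Subtype.ext (Equiv.Perm.ofSubtype_apply_of_mem σ ha)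
    have : SimpleGraph.extendAt v d (G.comap σ) =
        (SimpleGraph.extendAt v d G).comap (Equiv.Perm.ofSubtype σ) := by
      ext a b
      simp only [SimpleGraph.extendAt, comap_adj, hne, ne_eq, EmbeddingLike.apply_eq_iff_eq]
      refine or_congr Iff.rfl (exists_congr fun ha => exists_congr fun hb => ?_)
      rw [hcoe a ha, hcoe b hb]
    rw [this, hP.inv]
  bot := h0
  top := h1

/-- The complete graph on `A ⊕ C`, with edges given by `y` between `A` and a second copy of `A`. -/
def bipartiteJoin {A C : Type} (y : A × A → Bool) : SimpleGraph (A ⊕ A ⊕ C) where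
  Adj u w := match u, w with
    | .inl _, .inl _ => False
    | .inl a, .inr (.inl b) => y (a, b) = true
    | .inr (.inl b), .inl a => y (a, b) = true
    | .inl _, .inr (.inr _) => False
    | .inr (.inr _), .inl _ => False
    | .inr p, .inr q => p ≠ q
  symm := ⟨by
    rintro (a | b | c) (a' | b' | c') h
    all_goals first | exact h | exact Ne.symm h⟩
  loopless := ⟨by rintro (a | b | c) h <;> simp at h⟩

theorem bipartiteJoin_comap {A C : Type} [AddGroup A] (c : A × A) (y : A × A → Bool) :
    (bipartiteJoin (C := C) y).comap
      (Equiv.sumCongr (Equiv.addRight c.1) (Equiv.sumCongr (Equiv.addRight c.2) (Equiv.refl C))) =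
      bipartiteJoin fun j => y (j + c) := by
  ext (a | b | c) (a' | b' | c') <;> simp [bipartiteJoin, Prod.add_def]

/-- The hypotheses reject a complete graph plus an isolated vertex and accept a spanning star. In
`bipartiteJoin` the first copy of `A` is isolated at all-false, and each vertex of the second copy
is joined to all others at all-true; monotonicity decides both ends. `C` absorbs the surplus
vertices. -/
theorem IsMonotoneProperty.hasInvariantRestriction_sum {P : SimpleGraph V → Prop}
    (hP : IsMonotoneProperty P) {C : Type}
    (e : V ≃ (Fin k → ZMod 2) ⊕ (Fin k → ZMod 2) ⊕ C)
    (h0 : ∀ v, ¬ P (SimpleGraph.extendAt v False ⊤)) (h1 : ∀ v, P (SimpleGraph.extendAt v True ⊥)) :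
    HasInvariantRestriction k P := by
  refine ⟨fun y => (bipartiteJoin y).comap e, fun a b => ?_, fun c y => ?_, ?_, ?_⟩
  · simp only [comap_adj]
    rcases e a with a | a | a <;> rcases e b with b | b | b <;> simp only [bipartiteJoin]
    all_goals first | exact Or.inl ⟨_, fun _ => Iff.rfl⟩ | exact Or.inr ⟨_, fun _ => Iff.rfl⟩
  · have := (hP.comap e).inv (Equiv.sumCongr (Equiv.addRight c.1)
      (Equiv.sumCongr (Equiv.addRight c.2) (Equiv.refl C))) (bipartiteJoin y)
    rwa [bipartiteJoin_comap] at this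
  · refine fun h => h0 (e.symm (.inl 0)) (hP.mono _ _ (fun a b hab => ?_) h)
    have hne : a ≠ b := hab.ne
    refine Or.inr ⟨fun ha => ?_, fun hb => ?_, fun h => hne (congrArg Subtype.val h)⟩
    · subst ha
      revert hab
      simp only [comap_adj, Equiv.apply_symm_apply]
      rcases e b with b | b | b <;> simp [bipartiteJoin]
    · subst hb
      revert hab
      simp only [comap_adj, Equiv.apply_symm_apply]
      rcases e a with b | b | b <;> simp [bipartiteJoin]
  · refine hP.mono _ _ (fun a b hab => ?_) (h1 (e.symm (.inr (.inl 0))))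
    rcases hab with ⟨-, hne, hab⟩ | ⟨_, _, hab⟩
    · have hne' : e a ≠ e b := e.injective.ne hne
      simp only [Equiv.eq_symm_apply] at hab
      rw [comap_adj]
      generalize e a = a at *
      generalize e b = b at *
      rcases hab with rfl | rfl
      · rcases b with b | b | b <;> simp_all [bipartiteJoin]
      · rcases a with b | b | b <;> simp_all [bipartiteJoin]
    · exact absurd hab (by simp)

/-- Induction on the surplus over `2^(k+1)`. A vertex is removed by fixing it as isolated or as
joined to all, whenever the property stays nontrivial; if no vertex allows either,
`hasInvariantRestriction_sum` applies. -/
theorem IsMonotoneProperty.hasInvariantRestriction {V : Type} [Fintype V]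
    {P : SimpleGraph V → Prop} (hP : IsMonotoneProperty P) (hV : 2 ^ (k + 1) ≤ Fintype.card V) :
    HasInvariantRestriction k P := by
  classical
  obtain ⟨r, hr⟩ := Nat.exists_eq_add_of_le hV
  clear hV
  induction r generalizing V with
  | zero =>
    have e : V ≃ (Fin (k + 1) → ZMod 2) := Fintype.equivOfCardEq (by simp [hr])
    refine HasInvariantRestriction.of_comp (fun G => G.comap e) (fun a b => ?_)
      (hP.comap e).hasInvariantRestriction_cube
    exact Or.inr ⟨e a, e b, fun _ => Iff.rfl⟩
  | succ r ih =>
    have step : ∀ (v : V) (d : Prop), ¬ P (SimpleGraph.extendAt v d ⊥) →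
        P (SimpleGraph.extendAt v d ⊤) → HasInvariantRestriction k P := fun v d h0 h1 =>
      HasInvariantRestriction.of_comp _ (extendAt_adj_cases v d)
        (ih (hP.extendAt v d h0 h1) (by
          have := Fintype.card_congr (Equiv.optionSubtypeNe v)
          rw [Fintype.card_option, hr] at this
          omega))
    by_cases h0 : ∃ v, P (SimpleGraph.extendAt v False ⊤)
    · obtain ⟨v, hv⟩ := h0
      refine step v False (fun h => hP.bot (hP.mono _ _ (fun a b hab => ?_) h)) hv
      rcases hab with ⟨hab, -⟩ | ⟨_, _, hab⟩
      · exact hab.elim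
      · exact hab.elim
    by_cases h1 : ∃ v, ¬ P (SimpleGraph.extendAt v True ⊥)
    · obtain ⟨v, hv⟩ := h1
      refine step v True hv (hP.mono _ _ (fun a b hab => ?_) hP.top)
      by_cases ha : a = v
      · exact Or.inl ⟨trivial, hab, Or.inl ha⟩
      by_cases hb : b = v
      · exact Or.inl ⟨trivial, hab, Or.inr hb⟩
      · exact Or.inr ⟨ha, hb, fun h => hab (congrArg Subtype.val h)⟩
    push Not at h0 h1
    have e : V ≃ (Fin k → ZMod 2) ⊕ (Fin k → ZMod 2) ⊕ Fin (r + 1) :=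
      Fintype.equivOfCardEq (by simp [hr, pow_succ]; ring)
    exact hP.hasInvariantRestriction_sum e h0 h1

end SimpleGraph

/-! ### The quadratic lower bound -/

/-- If the graph property `P` is computed by querying edge bits, then `T` queries suffice for an
exact quantum algorithm only if `|V|² < 32 T`. -/
theorem SimpleGraph.IsMonotoneProperty.sq_lt {V I : Type} [Fintype V] [Fintype I] [DecidableEq I]
    {T : ℕ} {f : (I → Bool) → Bool} {A : QueryAlgorithm I T} (hA : A.ComputesExactly f)
    {bits : SimpleGraph V → I → Bool} (hbits : ∀ i, ∃ a b, ∀ G, bits G i = true ↔ G.Adj a b)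
    (hP : SimpleGraph.IsMonotoneProperty fun G => f (bits G) = true) :
    Fintype.card V ^ 2 < 32 * T := by
  obtain ⟨k, hk, hk'⟩ : ∃ k, 2 ^ (k + 1) ≤ Fintype.card V ∧ Fintype.card V < 2 ^ (k + 2) := by
    have h1 : 1 < Fintype.card V := by
      by_contra! h
      have : Subsingleton V := Fintype.card_le_one_iff_subsingleton.1 h
      exact hP.bot ((Subsingleton.elim (⊤ : SimpleGraph V) ⊥) ▸ hP.top)
    have hlog : 0 < Nat.log 2 (Fintype.card V) := Nat.log_pos one_lt_two h1
    refine ⟨Nat.log 2 (Fintype.card V) - 1, ?_, ?_⟩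
    · rw [Nat.sub_add_cancel hlog]
      exact Nat.pow_log_le_self 2 (by omega)
    · rw [show Nat.log 2 (Fintype.card V) - 1 + 2 = (Nat.log 2 (Fintype.card V)).succ by omega]
      exact Nat.lt_pow_succ_log_self one_lt_two _
  obtain ⟨Gr, h1, h2, h3, h4⟩ := hP.hasInvariantRestriction hk
  have hJ : Fintype.card ((Fin k → ZMod 2) × (Fin k → ZMod 2)) = 2 ^ (2 * k) := by
    simp [two_mul, pow_add]
  have hX : IsSubcube fun y => bits (Gr y) := by
    intro i
    obtain ⟨a, b, hab⟩ := hbits i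
    rcases h1 a b with ⟨c, hc⟩ | ⟨j, hj⟩
    · refine Or.inl ⟨bits (Gr fun _ => false) i, fun y => ?_⟩
      rw [Bool.eq_iff_iff, hab, hab, hc, hc]
    · refine Or.inr ⟨j, fun y => ?_⟩
      rw [Bool.eq_iff_iff, hab, hj]
  have hodd := odd_card_of_translation_invariant hJ (fun y => f (bits (Gr y)) = true) h2 h3 h4
  have := QueryAlgorithm.card_le_of_odd hA hX hodd
  rw [hJ] at this
  -- The 16 comes from `|V| < 4 · 2^k`, the further factor 2 from `4^k ≤ 2T`.
  calc Fintype.card V ^ 2 < (2 ^ (k + 2)) ^ 2 := Nat.pow_lt_pow_left hk' two_ne_zero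
    _ = 16 * 2 ^ (2 * k) := by ring
    _ ≤ 32 * T := by omega

/-- The infimum is attained unless it is `⊤`, where the bound is trivial. -/
theorem le_exactQuantumQueryComplexity {I : Type} [Fintype I] [DecidableEq I]
    {f : (I → Bool) → Bool} {n : ℕ}
    (h : ∀ T (A : QueryAlgorithm I T), A.ComputesExactly f → n ^ 2 < 32 * T) :
    ENNReal.ofReal (1 / 32 * (n : ℝ) ^ 2) ≤ (exactQuantumQueryComplexity f : ℝ≥0∞) := by
  rcases eq_or_ne (exactQuantumQueryComplexity f) ⊤ with htop | htop
  · rw [htop]; exact le_top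
  have hne : {q : ℕ∞ | ∃ T : ℕ, q = T ∧ ∃ A : QueryAlgorithm I T, A.ComputesExactly f}.Nonempty := by
    by_contra hcon
    rw [Set.not_nonempty_iff_eq_empty] at hcon
    exact htop (by rw [exactQuantumQueryComplexity, hcon, sInf_empty])
  obtain ⟨T, hT, A, hA⟩ := csInf_mem hne
  rw [exactQuantumQueryComplexity, hT]
  have h32 : ((n : ℝ)) ^ 2 ≤ 32 * T := by exact_mod_cast (h T A hA).le
  calc ENNReal.ofReal (1 / 32 * (n : ℝ) ^ 2) ≤ ENNReal.ofReal T :=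
        ENNReal.ofReal_le_ofReal (by linarith)
    _ = ((T : ℕ∞) : ℝ≥0∞) := by simp

theorem Monotone.eq_bot_top_of_nonconstant {I : Type} {f : (I → Bool) → Bool} (hf : Monotone f)
    (hc : ∃ x y, f x ≠ f y) : f ⊥ = false ∧ f ⊤ = true := by
  obtain ⟨x, y, hxy⟩ := hc
  constructor
  · by_contra h
    have h : f ⊥ = true := by simpa using h
    have hx : ∀ z, f z = true := fun z => top_le_iff.1 (h ▸ hf bot_le : true ≤ f z)
    exact hxy ((hx x).trans (hx y).symm)
  · by_contra h
    have h : f ⊤ = false := by simpa using h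
    have hx : ∀ z, f z = false := fun z => le_bot_iff.1 (h ▸ hf le_top : f z ≤ false)
    exact hxy ((hx x).trans (hx y).symm)

/-- The property is restricted to symmetric digraphs. Both orientations of an edge then carry the
same coordinate, which `IsSubcube` permits. -/
theorem IsMonotoneDigraphProperty.sq_lt {n T : ℕ} {P : (DiEdge n → Bool) → Bool}
    (hP : IsMonotoneDigraphProperty P) {A : QueryAlgorithm (DiEdge n) T}
    (hA : A.ComputesExactly P) : n ^ 2 < 32 * T := by
  classical
  have h := hP.monotone.eq_bot_top_of_nonconstant hP.nonconstant
  obtain ⟨bits, hb⟩ : ∃ bits : SimpleGraph (Fin n) → DiEdge n → Bool,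
      ∀ G e, bits G e = true ↔ G.Adj e.1.1 e.1.2 :=
    ⟨fun G e => decide (G.Adj e.1.1 e.1.2), fun G e => by simp⟩
  have := SimpleGraph.IsMonotoneProperty.sq_lt hA (V := Fin n) (bits := bits)
    (fun e => ⟨e.1.1, e.1.2, fun G => hb G e⟩)
    { mono := fun G H hGH hG => by
        refine top_le_iff.1 (hG.symm.le.trans (hP.monotone fun e => ?_))
        rw [Bool.le_iff_imp, hb, hb]
        exact fun h => hGH h
      inv := fun σ G => by
        have : bits (G.comap σ) = bits G ∘ DiEdge.map σ := by
          ext e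
          rw [Bool.eq_iff_iff, hb, Function.comp_apply, hb]
          rfl
        rw [this, hP.invariant]
      bot := by
        have : bits ⊥ = ⊥ := by
          ext e
          rw [Bool.eq_iff_iff, hb]
          simp
        rw [this, h.1]; simp
      top := by
        have : bits ⊤ = ⊤ := by
          ext e
          rw [Bool.eq_iff_iff, hb]
          simpa using e.2
        rw [this, h.2] }
  rwa [Fintype.card_fin] at this

theorem IsMonotoneGraphProperty.sq_lt {n T : ℕ} {P : (UEdge n → Bool) → Bool}
    (hP : IsMonotoneGraphProperty P) {A : QueryAlgorithm (UEdge n) T}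
    (hA : A.ComputesExactly P) : n ^ 2 < 32 * T := by
  classical
  have h := hP.monotone.eq_bot_top_of_nonconstant hP.nonconstant
  obtain ⟨bits, hb⟩ : ∃ bits : SimpleGraph (Fin n) → UEdge n → Bool,
      ∀ G e, bits G e = true ↔ e.1 ∈ G.edgeSet :=
    ⟨fun G e => decide (e.1 ∈ G.edgeSet), fun G e => by simp⟩
  have := SimpleGraph.IsMonotoneProperty.sq_lt hA (V := Fin n) (bits := bits)
    (fun e => by
      obtain ⟨⟨a, b⟩, _⟩ := e
      exact ⟨a, b, fun G => hb G _⟩)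
    { mono := fun G H hGH hG => by
        refine top_le_iff.1 (hG.symm.le.trans (hP.monotone fun e => ?_))
        rw [Bool.le_iff_imp, hb, hb]
        exact fun h => SimpleGraph.edgeSet_mono hGH h
      inv := fun σ G => by
        have : bits (G.comap σ) = bits G ∘ UEdge.map σ := by
          ext ⟨⟨a, b⟩, _⟩
          rw [Bool.eq_iff_iff, hb, Function.comp_apply, hb]
          rfl
        rw [this, hP.invariant]
      bot := by
        have : bits ⊥ = ⊥ := by
          ext e
          rw [Bool.eq_iff_iff, hb]
          simp
        rw [this, h.1]; simp
      top := by
        have : bits ⊤ = ⊤ := by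
          ext e
          rw [Bool.eq_iff_iff, hb]
          simpa using e.2
        rw [this, h.2] }
  rwa [Fintype.card_fin] at this

/-! ### Algorithms from Gram matrices -/

/-- Families of vectors with the same Gram matrix are related by a unitary. -/
theorem exists_unitary_mulVec_eq {X V : Type} [Fintype X] [Fintype V] [DecidableEq V]
    (α β : X → V → ℂ) (h : ∀ x y, star (α x) ⬝ᵥ α y = star (β x) ⬝ᵥ β y) :
    ∃ U : Matrix.unitaryGroup V ℂ, ∀ x, U.1 *ᵥ α x = β x := by
  classical
  let lin (γ : X → V → ℂ) : (X → ℂ) →ₗ[ℂ] EuclideanSpace ℂ V :=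
    Fintype.linearCombination ℂ fun x => WithLp.toLp 2 (γ x)
  have hin : ∀ u v : V → ℂ, inner ℂ (WithLp.toLp 2 u : EuclideanSpace ℂ V) (WithLp.toLp 2 v) =
      star u ⬝ᵥ v := fun u v => by
    rw [EuclideanSpace.inner_eq_star_dotProduct, dotProduct_comm]
  have hlin : ∀ γ c d, inner ℂ (lin γ c) (lin γ d) =
      ∑ y, d y * ∑ x, starRingEnd ℂ (c x) * (star (γ x) ⬝ᵥ γ y) := fun γ c d => by
    simp only [lin, Fintype.linearCombination_apply, sum_inner, inner_sum, inner_smul_left,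
      inner_smul_right]
    simp only [hin]
  have hnorm : ∀ c, ‖lin β c‖ = ‖lin α c‖ := fun c => by
    rw [@norm_eq_sqrt_re_inner ℂ, @norm_eq_sqrt_re_inner ℂ _ _ _ _ (lin α c), hlin, hlin]
    simp only [h]
  obtain ⟨g, hg⟩ := LinearMap.exists_rightInverse_of_surjective (lin α).rangeRestrict
    (LinearMap.range_rangeRestrict _)
  have hg' : ∀ s, lin α (g s) = s := fun s => congrArg Subtype.val (LinearMap.congr_fun hg s)
  let L : LinearMap.range (lin α) →ₗᵢ[ℂ] EuclideanSpace ℂ V :=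
    { toLinearMap := (lin β).comp g
      norm_map' := fun s => by
        rw [LinearMap.comp_apply, hnorm, hg', Submodule.coe_norm] }
  -- `g (lin α c)` and `c` differ by an element of the kernel of `lin α`, which `lin β` also kills
  -- since the norms agree.
  have hL : ∀ c, L.extend (lin α c) = lin β c := fun c => by
    have hc := L.extend_apply ⟨lin α c, LinearMap.mem_range_self _ c⟩
    rw [hc]
    change lin β (g _) = _
    rw [← sub_eq_zero, ← map_sub, ← norm_eq_zero, hnorm, map_sub, hg', sub_self, norm_zero]
  let M : Matrix V V ℂ := Matrix.toEuclideanLin.symm L.extend.toLinearMap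
  have hM : ∀ v : V → ℂ, WithLp.toLp 2 (M *ᵥ v) = L.extend (WithLp.toLp 2 v) := fun v => by
    have := LinearMap.congr_fun (Matrix.toEuclideanLin.apply_symm_apply L.extend.toLinearMap)
      (WithLp.toLp 2 v)
    exact this
  refine ⟨⟨M, ?_⟩, fun x => ?_⟩
  · rw [Matrix.mem_unitaryGroup_iff']
    ext i j
    have h1 : (star M * M) i j = star (M *ᵥ Pi.single i 1) ⬝ᵥ (M *ᵥ Pi.single j 1) := by
      simp [Matrix.mul_apply, dotProduct]
    rw [h1, ← hin, hM, hM, LinearIsometry.inner_map_map, hin]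
    simp [Matrix.one_apply, Pi.single_apply, eq_comm]
  · have hs : ∀ γ : X → V → ℂ, lin γ (Pi.single x 1) = WithLp.toLp 2 (γ x) := fun γ => by
      simp [lin]
    have := hL (Pi.single x 1)
    rw [hs, hs, ← hM] at this
    exact WithLp.toLp_injective 2 this

section StateFamilies

variable {I : Type}

/-- The query gate with an arbitrary workspace `Z`. -/
def oracleGate {Z : Type} (x : I → Bool) (ψ : I × Bool × Z → ℂ) : I × Bool × Z → ℂ :=
  fun v => ψ (v.1, xor v.2.1 (x v.1), v.2.2)

theorem oracleGate_smul {Z : Type} (x : I → Bool) (c : ℂ) (ψ : I × Bool × Z → ℂ) :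
    oracleGate x (c • ψ) = c • oracleGate x ψ := rfl

theorem oracleGate_zero {Z : Type} (x : I → Bool) :
    oracleGate x (0 : I × Bool × Z → ℂ) = 0 := rfl

theorem oracleGate_dotProduct_self [Fintype I] {Z : Type} [Fintype Z] (x : I → Bool)
    (ψ : I × Bool × Z → ℂ) : star (oracleGate x ψ) ⬝ᵥ oracleGate x ψ = star ψ ⬝ᵥ ψ := by
  have hinv : Function.Involutive fun v : I × Bool × Z => (v.1, xor v.2.1 (x v.1), v.2.2) := by
    rintro ⟨j, b, z⟩
    simp
  exact Equiv.sum_comp hinv.toPerm fun v => star (ψ v) * ψ v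

/-- The states of an exact algorithm for `f` with `T` queries, just before each of the queries and
at the end: only the inner products between the states on different inputs are constrained. -/
def HasStateFamily [Fintype I] (T : ℕ) (f : (I → Bool) → Bool) : Prop :=
  ∃ (Z : Type) (_ : Fintype Z) (out : Z → Bool) (φ : ℕ → (I → Bool) → I × Bool × Z → ℂ),
    (∀ x y, star (φ 0 x) ⬝ᵥ φ 0 y = 1) ∧
    (∀ t < T, ∀ x y, star (φ (t + 1) x) ⬝ᵥ φ (t + 1) y =
      star (oracleGate x (φ t x)) ⬝ᵥ oracleGate y (φ t y)) ∧
    ∀ x v, φ T x v ≠ 0 → out v.2.2 = f x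

/-- A vector of amplitudes with workspace `Z₀`, extended by zero along an injection of `Z₀` into
the workspace `Z`. -/
noncomputable def extendWorkspace {Z₀ Z : Type} (enc : Z₀ → Z) (ψ : I × Bool × Z₀ → ℂ) :
    I × Bool × Z → ℂ :=
  Function.extend (fun v => (v.1, v.2.1, enc v.2.2)) ψ 0

section

variable {Z₀ Z : Type} {enc : Z₀ → Z} (henc : Function.Injective enc)
include henc

theorem workspaceMap_injective :
    Function.Injective fun v : I × Bool × Z₀ => (v.1, v.2.1, enc v.2.2) := by
  rintro ⟨j, b, z⟩ ⟨j', b', z'⟩ h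
  simpa [henc.eq_iff] using h

theorem extendWorkspace_apply (ψ : I × Bool × Z₀ → ℂ) (v : I × Bool × Z₀) :
    extendWorkspace enc ψ (v.1, v.2.1, enc v.2.2) = ψ v :=
  (workspaceMap_injective henc).extend_apply ψ 0 v

theorem extendWorkspace_dotProduct [Fintype I] [Fintype Z₀] [Fintype Z]
    (ψ χ : I × Bool × Z₀ → ℂ) :
    star (extendWorkspace enc ψ) ⬝ᵥ extendWorkspace enc χ = star ψ ⬝ᵥ χ := by
  symm
  refine Fintype.sum_of_injective _ (workspaceMap_injective henc) _ _ (fun v hv => ?_) fun v => ?_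
  · have : extendWorkspace enc χ v = 0 := Function.extend_apply' _ _ _ (by simpa using hv)
    rw [this, mul_zero]
  · rw [Pi.star_apply, Pi.star_apply, extendWorkspace_apply henc, extendWorkspace_apply henc]

theorem oracleGate_extendWorkspace (x : I → Bool) (ψ : I × Bool × Z₀ → ℂ) :
    oracleGate x (extendWorkspace enc ψ) = extendWorkspace enc (oracleGate x ψ) := by
  ext ⟨j, b, z⟩
  by_cases hz : ∃ z₀, enc z₀ = z
  · obtain ⟨z₀, rfl⟩ := hz
    exact (extendWorkspace_apply henc ψ (j, xor b (x j), z₀)).trans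
      (extendWorkspace_apply henc (oracleGate x ψ) (j, b, z₀)).symm
  · have h0 : ∀ (χ : I × Bool × Z₀ → ℂ) b, extendWorkspace enc χ (j, b, z) = 0 := fun χ b =>
      Function.extend_apply' _ _ _ fun ⟨v, hv⟩ => hz ⟨v.2.2, congrArg (fun u => u.2.2) hv⟩
    exact (h0 ψ _).trans (h0 _ b).symm

end

/-- Between queries the Gram matrices over all inputs agree, so one input-independent unitary
carries the queried states to the next ones. -/
theorem HasStateFamily.exists_algorithm [Fintype I] [DecidableEq I] [Nonempty I] {T : ℕ}
    {f : (I → Bool) → Bool} (h : HasStateFamily T f) :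
    ∃ A : QueryAlgorithm I T, A.ComputesExactly f := by
  classical
  obtain ⟨Z, _, out, φ, h0, hstep, hout⟩ := h
  obtain ⟨start⟩ := ‹Nonempty I›
  let m := Fintype.card Z + 1
  -- Qubit 0 holds the output; the others encode `z` in one-hot form, making the encoding injective.
  let enc : Z → Fin m → Bool := fun z =>
    Fin.cons (out z) fun i => decide (Fintype.equivFin Z z = i)
  have henc : Function.Injective enc := fun z z' hzz => by
    have := congrFun (Fin.cons_injective2 hzz).2 (Fintype.equivFin Z z)
    simpa [eq_comm] using this
  have hunit : ∀ t ≤ T, ∀ x, star (φ t x) ⬝ᵥ φ t x = 1 := by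
    intro t
    induction t with
    | zero => exact fun _ x => h0 x x
    | succ t ih =>
      intro ht x
      rw [hstep t ht, oracleGate_dotProduct_self, ih (Nat.le_of_succ_le ht)]
  obtain ⟨U₀, hU₀⟩ := exists_unitary_mulVec_eq
    (fun _ : I → Bool => (Pi.single (start, false, fun _ => false) 1 : BasisLabel I m → ℂ))
    (fun x => extendWorkspace enc (φ 0 x)) (fun x y => by
      rw [extendWorkspace_dotProduct henc, h0]
      simp)
  have hU : ∀ t : Fin T, ∃ U : Matrix.unitaryGroup (BasisLabel I m) ℂ, ∀ x,
      U.1 *ᵥ oracleGate x (extendWorkspace enc (φ t x)) = extendWorkspace enc (φ (t + 1) x) :=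
    fun t => exists_unitary_mulVec_eq _ _ fun x y => by
      rw [oracleGate_extendWorkspace henc, oracleGate_extendWorkspace henc,
        extendWorkspace_dotProduct henc, extendWorkspace_dotProduct henc, hstep t t.2]
  choose U hU using hU
  let A : QueryAlgorithm I T := ⟨m, start, 0, Fin.cons U₀ U⟩
  have hstate : ∀ x t, A.state x t = extendWorkspace enc (φ t x) := fun x t => by
    induction t using Fin.induction with
    | zero => exact hU₀ x
    | succ t ih =>
      rw [A.state_succ, ih]
      exact hU t x
  refine ⟨A, fun x => ?_⟩
  have hsum : A.acceptProb x =
      ∑ v : I × Bool × Z, if out v.2.2 = true then ‖φ T x v‖ ^ 2 else 0 := by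
    symm
    refine Fintype.sum_of_injective _ (workspaceMap_injective henc) _ _
      (fun v hv => ?_) fun v => ?_
    · rw [hstate]
      have : extendWorkspace enc (φ T x) v = 0 := Function.extend_apply' _ _ _ (by simpa using hv)
      simp [this]
    · rw [hstate, Fin.val_last, extendWorkspace_apply henc]
      rfl
  have hterm : ∀ v : I × Bool × Z, (if out v.2.2 = true then ‖φ T x v‖ ^ 2 else 0) =
      if f x = true then ‖φ T x v‖ ^ 2 else 0 := fun v => by
    by_cases hv : φ T x v = 0
    · simp [hv]
    · rw [hout x v hv]
  rw [hsum]
  simp only [hterm]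
  split_ifs
  · have := hunit T le_rfl x
    have h2 : ((∑ v : I × Bool × Z, ‖φ T x v‖ ^ 2 : ℝ) : ℂ) = 1 := by
      rw [← this, dotProduct]
      push_cast
      refine Finset.sum_congr rfl fun v _ => ?_
      rw [Pi.star_apply, RCLike.star_def, Complex.conj_mul']
    exact_mod_cast h2
  · simp

/-- Amplitudes on a disjoint union of three workspaces. -/
def glueWorkspaces {Z Z₀ Z₁ : Type} (u : I × Bool × Z → ℂ) (ψ₀ : I × Bool × Z₀ → ℂ)
    (ψ₁ : I × Bool × Z₁ → ℂ) : I × Bool × (Z ⊕ Z₀ ⊕ Z₁) → ℂ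
  | (j, b, .inl z) => u (j, b, z)
  | (j, b, .inr (.inl z)) => ψ₀ (j, b, z)
  | (j, b, .inr (.inr z)) => ψ₁ (j, b, z)

theorem oracleGate_glueWorkspaces {Z Z₀ Z₁ : Type} (x : I → Bool) (u : I × Bool × Z → ℂ)
    (ψ₀ : I × Bool × Z₀ → ℂ) (ψ₁ : I × Bool × Z₁ → ℂ) :
    oracleGate x (glueWorkspaces u ψ₀ ψ₁) =
      glueWorkspaces (oracleGate x u) (oracleGate x ψ₀) (oracleGate x ψ₁) := by
  ext ⟨j, b, z | z | z⟩ <;> rfl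

theorem glueWorkspaces_dotProduct [Fintype I] {Z Z₀ Z₁ : Type} [Fintype Z] [Fintype Z₀]
    [Fintype Z₁] (u u' : I × Bool × Z → ℂ) (ψ₀ ψ₀' : I × Bool × Z₀ → ℂ)
    (ψ₁ ψ₁' : I × Bool × Z₁ → ℂ) :
    star (glueWorkspaces u ψ₀ ψ₁) ⬝ᵥ glueWorkspaces u' ψ₀' ψ₁' =
      star u ⬝ᵥ u' + (star ψ₀ ⬝ᵥ ψ₀' + star ψ₁ ⬝ᵥ ψ₁') := by
  simp only [dotProduct, Fintype.sum_prod_type, Fintype.sum_sum_type, Finset.sum_add_distrib]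
  rfl

/-! ### Values obtained by one query and their adaptive composition -/

/-- The value `a x` can be extracted by a single query: after the query, states with different values
of `a` are orthogonal, and states with the same value agree up to a phase. -/
def IsOneQuery [Fintype I] (a : (I → Bool) → Bool) : Prop :=
  ∃ (w : I × Bool × Unit → ℂ) (s : (I → Bool) → ℂ), star w ⬝ᵥ w = 1 ∧
    ∀ x y, star (oracleGate x w) ⬝ᵥ oracleGate y w = if a x = a y then star (s x) * s y else 0

theorem isOneQuery_bit [Fintype I] [DecidableEq I] (i : I) : IsOneQuery fun x => x i := by
  have h : ∀ x : I → Bool, oracleGate x (Pi.single (i, false, ()) 1) =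
      Pi.single (i, x i, ()) 1 := fun x => by
    ext ⟨j, b, _⟩
    by_cases hj : j = i
    · subst hj
      cases b <;> cases hx : x j <;> simp [oracleGate, hx]
    · simp [oracleGate, hj]
  refine ⟨Pi.single (i, false, ()) 1, fun _ => 1, by simp, fun x y => ?_⟩
  rw [h, h]
  simp [Pi.single_apply, eq_comm]

/-- Deutsch's algorithm: with the target in the minus state, querying an equal superposition of `i`
and `j` writes the bits as signs. Only the relative sign matters; `(-1)^(x i)` is a global phase. -/
theorem isOneQuery_xor [Fintype I] [DecidableEq I] {i j : I} (hij : i ≠ j) :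
    IsOneQuery fun x => xor (x i) (x j) := by
  let w : I × Bool × Unit → ℂ := fun v =>
    if v.1 = i ∨ v.1 = j then (if v.2.1 = true then -(1 / 2) else 1 / 2) else 0
  have h : ∀ x y : I → Bool, star (oracleGate x w) ⬝ᵥ oracleGate y w =
      1 / 2 * ((if x i = y i then 1 else -1) + if x j = y j then 1 else -1) := fun x y => by
    rw [dotProduct, Fintype.sum_prod_type, Fintype.sum_eq_add i j hij]
    · simp only [Fintype.sum_prod_type, Fintype.sum_bool, Finset.univ_unique, Finset.sum_singleton]
      cases hxi : x i <;> cases hyi : y i <;> cases hxj : x j <;> cases hyj : y j <;>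
        simp [oracleGate, w, hxi, hyi, hxj, hyj] <;> norm_num
    · rintro k ⟨hki, hkj⟩
      simp [oracleGate, w, hki, hkj]
  refine ⟨w, fun x => if x i = true then -1 else 1, ?_, fun x y => ?_⟩
  · rw [← oracleGate_dotProduct_self (fun _ => false), h]
    norm_num
  · rw [h]
    cases hxi : x i <;> cases hyi : y i <;> cases hxj : x j <;> cases hyj : y j <;>
      simp [hxi, hyi, hxj, hyj] <;> norm_num

/-- Functions computed by adaptive sequences of `T` values extracted with one query each. -/
inductive DecidedWithQueries [Fintype I] : ℕ → ((I → Bool) → Bool) → Prop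
  | const (b : Bool) : DecidedWithQueries 0 fun _ => b
  | step {T : ℕ} {a f₀ f₁ : (I → Bool) → Bool} (ha : IsOneQuery a) (h₀ : DecidedWithQueries T f₀)
      (h₁ : DecidedWithQueries T f₁) :
      DecidedWithQueries (T + 1) fun x => if a x = true then f₁ x else f₀ x

theorem HasStateFamily.const [Fintype I] [Nonempty I] (b : Bool) :
    HasStateFamily 0 fun _ : I → Bool => b := by
  classical
  obtain ⟨i⟩ := ‹Nonempty I›
  exact ⟨Unit, inferInstance, fun _ => b, fun _ _ => Pi.single (i, false, ()) 1, by simp, by simp,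
    fun _ _ _ => rfl⟩

/-- After the query, inputs with different `a` have orthogonal states, so the two continuations can
live on disjoint workspaces. The phase `s x` is carried along to match the Gram matrix. -/
theorem HasStateFamily.step [Fintype I] {T : ℕ} {a f₀ f₁ : (I → Bool) → Bool} (ha : IsOneQuery a)
    (h₀ : HasStateFamily T f₀) (h₁ : HasStateFamily T f₁) :
    HasStateFamily (T + 1) fun x => if a x = true then f₁ x else f₀ x := by
  obtain ⟨w, s, hw, hs⟩ := ha
  obtain ⟨Z₀, _, out₀, φ₀, h0₀, hstep₀, hout₀⟩ := h₀
  obtain ⟨Z₁, _, out₁, φ₁, h0₁, hstep₁, hout₁⟩ := h₁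
  let φ : ℕ → (I → Bool) → I × Bool × (Unit ⊕ Z₀ ⊕ Z₁) → ℂ := fun t x => match t with
    | 0 => glueWorkspaces w 0 0
    | t + 1 => if a x = true then glueWorkspaces 0 0 (s x • φ₁ t x)
        else glueWorkspaces 0 (s x • φ₀ t x) 0
  refine ⟨Unit ⊕ Z₀ ⊕ Z₁, inferInstance, Sum.elim (fun _ => false) (Sum.elim out₀ out₁), φ,
    fun x y => ?_, fun t ht x y => ?_, fun x v hv => ?_⟩
  · simp [φ, glueWorkspaces_dotProduct, hw]
  · cases t with
    | zero =>
      cases hx : a x <;> cases hy : a y <;>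
        simp [φ, hx, hy, glueWorkspaces_dotProduct, oracleGate_glueWorkspaces, oracleGate_zero, hs,
          h0₀, h0₁, mul_comm]
    | succ t =>
      have e₀ := hstep₀ t (Nat.lt_of_succ_lt_succ ht) x y
      have e₁ := hstep₁ t (Nat.lt_of_succ_lt_succ ht) x y
      cases hx : a x <;> cases hy : a y <;>
        simp [φ, hx, hy, glueWorkspaces_dotProduct, oracleGate_glueWorkspaces, oracleGate_zero,
          oracleGate_smul, e₀, e₁]
  · obtain ⟨j, b, z⟩ := v
    cases hx : a x <;> rcases z with z | z | z <;> simp [φ, hx, glueWorkspaces] at hv ⊢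
    · exact hout₀ x _ hv.2
    · exact hout₁ x _ hv.2

theorem DecidedWithQueries.hasStateFamily [Fintype I] [Nonempty I] {T : ℕ}
    {f : (I → Bool) → Bool} (h : DecidedWithQueries T f) : HasStateFamily T f := by
  induction h with
  | const b => exact HasStateFamily.const b
  | step ha _ _ ih₀ ih₁ => exact HasStateFamily.step ha ih₀ ih₁

theorem DecidedWithQueries.exactQuantumQueryComplexity_le [Fintype I] [DecidableEq I] [Nonempty I]
    {T : ℕ} {f : (I → Bool) → Bool} (h : DecidedWithQueries T f) :
    exactQuantumQueryComplexity f ≤ T :=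
  sInf_le ⟨T, rfl, h.hasStateFamily.exists_algorithm⟩

/-- Padding: query an arbitrary bit and continue identically in both branches. -/
theorem DecidedWithQueries.mono [Fintype I] [DecidableEq I] [Nonempty I] {T T' : ℕ}
    {f : (I → Bool) → Bool} (h : DecidedWithQueries T f) (hT : T ≤ T') :
    DecidedWithQueries T' f := by
  induction hT with
  | refl => exact h
  | step _ ih =>
    obtain ⟨i⟩ := ‹Nonempty I›
    simpa using DecidedWithQueries.step (isOneQuery_bit i) ih ih

theorem decidedWithQueries_bit [Fintype I] [DecidableEq I] (i : I) :
    DecidedWithQueries 1 fun x => x i := by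
  simpa using DecidedWithQueries.step (isOneQuery_bit i) (.const false) (.const true)

end StateFamilies

/-! ### Majority by pairwise comparison -/

section Majority

variable {I : Type}

/-- The number of ones minus the number of zeros of `x` on the positions in `L`. -/
def bitBalance (L : List I) (x : I → Bool) : ℤ :=
  (L.map fun i => if x i = true then 1 else -1).sum

/-- The sign of the sum of the positions in `L` with weight `1` and those in `M` with weight `2`,
with ties decided by `r`. -/
def weightedMajority (L M : List I) (r : Option I) (x : I → Bool) : Bool :=
  if bitBalance L x + 2 * bitBalance M x = 0 then r.elim false x
  else decide (0 < bitBalance L x + 2 * bitBalance M x)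

theorem bitBalance_nil (x : I → Bool) : bitBalance [] x = 0 := rfl

theorem bitBalance_cons (i : I) (L : List I) (x : I → Bool) :
    bitBalance (i :: L) x = (if x i = true then 1 else -1) + bitBalance L x := by
  simp [bitBalance]

theorem weightedMajority_cons_cons (i j : I) (L M : List I) (r : Option I) :
    weightedMajority (i :: j :: L) M r = fun x =>
      if xor (x i) (x j) = true then weightedMajority L M r x
      else weightedMajority L (i :: M) r x := by
  ext x
  simp only [weightedMajority, bitBalance_cons]
  cases hi : x i <;> cases hj : x j <;>
    simp only [Bool.xor_false, Bool.xor_true, Bool.not_true, Bool.not_false, if_true, if_false,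
      Bool.false_eq_true] <;> ring_nf

/-- A single weight 1 beside even weights matters only when the latter balance, so it becomes the
tie-breaker. The total is odd, so the old `r` is never consulted. -/
theorem weightedMajority_singleton (i : I) (M : List I) (r : Option I) :
    weightedMajority [i] M r = weightedMajority M [] (some i) := by
  ext x
  simp only [weightedMajority, bitBalance_cons, bitBalance_nil, Option.elim_some]
  generalize bitBalance M x = b
  cases hi : x i <;> simp only [if_true, if_false, Bool.false_eq_true] <;> split_ifs <;>
    first | omega | (rw [Bool.eq_iff_iff]; simp; omega)

theorem weightedMajority_nil (M : List I) (r : Option I) :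
    weightedMajority [] M r = weightedMajority M [] r := by
  ext x
  simp only [weightedMajority, bitBalance_nil]
  generalize bitBalance M x = b
  split_ifs <;> first | omega | (simp; try omega)

theorem weightedMajority_nil_nil (r : Option I) :
    weightedMajority [] [] r = fun x => r.elim false x := by
  ext x
  simp [weightedMajority, bitBalance_nil]

variable [Fintype I]

theorem weightedMajority_toList (x : I → Bool) :
    weightedMajority (Finset.univ : Finset I).toList [] none x =
      decide (Fintype.card I < 2 * (Finset.univ.filter fun e => x e = true).card) := by
  have h : bitBalance (Finset.univ : Finset I).toList x =
      2 * ((Finset.univ.filter fun e => x e = true).card : ℤ) - Fintype.card I := by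
    have h1 : ∀ i : I, (if x i = true then (1 : ℤ) else -1) =
        2 * (if x i = true then 1 else 0) - 1 := fun i => by split_ifs <;> rfl
    rw [bitBalance, Finset.sum_map_toList]
    simp only [h1, Finset.sum_sub_distrib, ← Finset.mul_sum, Finset.sum_boole]
    simp
  simp only [weightedMajority, h, bitBalance_nil, Option.elim_none]
  split_ifs
  · symm; rw [decide_eq_false_iff_not]; omega
  · rw [decide_eq_decide]; omega

variable [DecidableEq I] [Nonempty I]

/-- The tie-breaker is free once a position remains: the lists run empty either by a cancellation,
which spends one query on two positions, or when the last position itself becomes the tie-breaker.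
-/
theorem decidedWithQueries_weightedMajority (L M : List I) (r : Option I) (hnd : (L ++ M).Nodup)
    {d : ℕ} (hd : L.length + M.length ≤ d) (hr : L = [] → M = [] → r.isSome → 1 ≤ d) :
    DecidedWithQueries d (weightedMajority L M r) := by
  -- Weights 2 and 3 make the measure drop both when a pair merges (`-4 + 3`) and when `M` is
  -- rescaled to weight 1.
  induction hn : 2 * L.length + 3 * M.length using Nat.strong_induction_on
    generalizing L M r d with
  | _ n ih =>
    match L with
    | [] =>
      match M with
      | [] =>
        rw [weightedMajority_nil_nil]
        match r with
        | none => exact (DecidedWithQueries.const false).mono (Nat.zero_le d)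
        | some i => exact (decidedWithQueries_bit i).mono (hr rfl rfl rfl)
      | m :: M =>
        rw [weightedMajority_nil]
        refine ih _ ?_ _ _ _ (by simpa using hnd) ?_ (by simp) rfl <;>
          simp only [List.length_cons, List.length_nil] at * <;> omega
    | [i] =>
      rw [weightedMajority_singleton]
      simp only [List.length_cons, List.length_nil] at hd hn
      exact ih _ (by simp only [List.length_nil]; omega) _ _ _
        (by simpa using (List.nodup_cons.1 hnd).2) (by simp only [List.length_nil]; omega)
        (fun _ _ _ => by omega) rfl
    | i :: j :: L =>
      simp only [List.length_cons] at hd hn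
      obtain ⟨d, rfl⟩ := Nat.exists_eq_succ_of_ne_zero (show d ≠ 0 by omega)
      rw [List.cons_append, List.cons_append, List.nodup_cons, List.nodup_cons] at hnd
      have hij : i ≠ j := fun h => hnd.1 (h ▸ List.mem_cons_self)
      have hnd' : (L ++ i :: M).Nodup := List.perm_middle.nodup_iff.2
        (List.nodup_cons.2 ⟨fun h => hnd.1 (List.mem_cons_of_mem _ h), hnd.2.2⟩)
      rw [weightedMajority_cons_cons]
      refine .step (isOneQuery_xor hij) (ih _ ?_ _ _ _ hnd' ?_ (by simp) rfl)
        (ih _ ?_ _ _ _ hnd.2.2 ?_ (fun _ _ _ => ?_) rfl) <;>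
        first | omega | (simp only [List.length_cons]; omega)

/-- Unless the total weight is a power of two, one query can be saved. -/
theorem decidedWithQueries_weightedMajority_none (L M : List I) (hnd : (L ++ M).Nodup) {d : ℕ}
    (hpow : ∀ a, L.length + 2 * M.length ≠ 2 ^ a) (hd : L.length + M.length ≤ d + 1) :
    DecidedWithQueries d (weightedMajority L M none) := by
  induction hn : 2 * L.length + 3 * M.length using Nat.strong_induction_on
    generalizing L M d with
  | _ n ih =>
    match L with
    | [] =>
      match M with
      | [] =>
        rw [weightedMajority_nil_nil]
        exact (DecidedWithQueries.const false).mono (Nat.zero_le d)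
      | m :: M =>
        rw [weightedMajority_nil]
        refine ih _ ?_ _ _ (by simpa using hnd) (fun a ha => hpow (a + 1) ?_) ?_ rfl <;>
          simp only [List.length_cons, List.length_nil] at * <;> omega
    | [i] =>
      rw [weightedMajority_singleton]
      simp only [List.length_cons, List.length_nil] at hd hpow
      -- Here the query is saved: `i` only breaks ties among the positions of `M`, and with `M`
      -- nonempty that costs nothing extra. An empty `M` would mean total weight `2^0`.
      have hM : M ≠ [] := fun h => hpow 0 (by simp [h])
      exact decidedWithQueries_weightedMajority _ _ _ (by simpa using (List.nodup_cons.1 hnd).2)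
        (by simp only [List.length_nil]; omega) fun h => absurd h hM
    | i :: j :: L =>
      simp only [List.length_cons] at hd hn hpow
      obtain ⟨d, rfl⟩ := Nat.exists_eq_succ_of_ne_zero (show d ≠ 0 by omega)
      rw [List.cons_append, List.cons_append, List.nodup_cons, List.nodup_cons] at hnd
      have hij : i ≠ j := fun h => hnd.1 (h ▸ List.mem_cons_self)
      have hnd' : (L ++ i :: M).Nodup := List.perm_middle.nodup_iff.2
        (List.nodup_cons.2 ⟨fun h => hnd.1 (List.mem_cons_of_mem _ h), hnd.2.2⟩)
      rw [weightedMajority_cons_cons]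
      -- Merging preserves the total weight, so the induction continues; cancelling removes two
      -- positions for one query, which is the saving.
      refine .step (isOneQuery_xor hij)
        (ih _ ?_ _ _ hnd' (fun a ha => hpow a (by rw [← ha, List.length_cons]; ring)) ?_ rfl)
        (decidedWithQueries_weightedMajority _ _ _ hnd.2.2 ?_ (by simp)) <;>
        first | omega | (simp only [List.length_cons]; omega)

/-- The exact quantum query complexity of the majority of `N` bits is less than `N` unless `N` is
a power of two. -/
theorem exactQuantumQueryComplexity_majority_lt (hpow : ∀ a, Fintype.card I ≠ 2 ^ a) :
    exactQuantumQueryComplexity (fun x : I → Bool =>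
      decide (Fintype.card I < 2 * (Finset.univ.filter fun e => x e = true).card)) <
      Fintype.card I := by
  have h := decidedWithQueries_weightedMajority_none (d := Fintype.card I - 1)
    (Finset.univ : Finset I).toList [] (by simpa using Finset.nodup_toList _)
    (by simpa using hpow) (by simp; omega)
  rw [funext weightedMajority_toList] at h
  refine h.exactQuantumQueryComplexity_le.trans_lt ?_
  have := Fintype.card_pos (α := I)
  exact_mod_cast (by omega : Fintype.card I - 1 < Fintype.card I)

end Majority

/-! ### Edge counts and the main theorem -/

/-- Both factors would be powers of two; being consecutive, one of them is odd and hence 1. -/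
theorem Nat.mul_sub_one_ne_two_pow {n : ℕ} (hn : 2 < n) (a : ℕ) : n * (n - 1) ≠ 2 ^ a := by
  intro h
  obtain ⟨b, -, hb⟩ := (Nat.dvd_prime_pow Nat.prime_two).1 (Dvd.intro _ h)
  obtain ⟨c, -, hc⟩ := (Nat.dvd_prime_pow Nat.prime_two).1 (Dvd.intro_left _ h)
  rcases b with - | b
  · simp at hb; omega
  rcases c with - | c
  · simp at hc; omega
  rw [pow_succ] at hb hc
  omega

theorem Nat.choose_two_ne_two_pow {n : ℕ} (hn : 2 < n) (a : ℕ) : n.choose 2 ≠ 2 ^ a := by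
  intro h
  refine Nat.mul_sub_one_ne_two_pow hn (a + 1) ?_
  rw [pow_succ, ← h, Nat.choose_two_right,
    Nat.div_mul_cancel (Nat.even_mul_pred_self n).two_dvd]

theorem DiEdge.card (n : ℕ) : Fintype.card (DiEdge n) = n * (n - 1) := by
  have h := Fintype.card_subtype_compl fun e : Fin n × Fin n => e.1 = e.2
  have hdiag : Fintype.card {e : Fin n × Fin n // e.1 = e.2} = n := by
    rw [Fintype.card_congr (β := Fin n)
      ⟨fun e => e.1.1, fun i => ⟨(i, i), rfl⟩, fun ⟨⟨a, b⟩, h⟩ => by cases h; rfl, fun _ => rfl⟩,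
      Fintype.card_fin]
  rw [hdiag, Fintype.card_prod, Fintype.card_fin] at h
  rw [Nat.mul_sub_one, ← h]

theorem UEdge.card (n : ℕ) : Fintype.card (UEdge n) = n.choose 2 := by
  have := Sym2.card_subtype_not_diag (α := Fin n)
  rw [Fintype.card_fin] at this
  rw [← this]

section

variable {I : Type} [Fintype I]

theorem card_filter_comp_of_injective (x : I → Bool) {σ : I → I} (hσ : Function.Injective σ) :
    (Finset.univ.filter fun e => (x ∘ σ) e = true).card =
      (Finset.univ.filter fun e => x e = true).card :=
  Finset.card_bijective σ (Finite.injective_iff_bijective.1 hσ) (by simp)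

theorem monotone_card_filter :
    Monotone fun x : I → Bool => (Finset.univ.filter fun e => x e = true).card := fun _ _ hxy =>
  Finset.card_le_card (Finset.monotone_filter_right _ fun e _ he => Bool.le_iff_imp.1 (hxy e) he)

theorem monotone_decide_lt_two_mul_card (N : ℕ) : Monotone fun x : I → Bool =>
    decide (N < 2 * (Finset.univ.filter fun e => x e = true).card) := fun x y hxy => by
  have := monotone_card_filter hxy
  dsimp only at this ⊢
  rw [Bool.le_iff_imp, decide_eq_true_iff, decide_eq_true_iff]
  omega

end

theorem DiEdge.map_injective {n : ℕ} (σ : Equiv.Perm (Fin n)) :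
    Function.Injective (DiEdge.map σ) := by
  rintro ⟨⟨a, b⟩, h⟩ ⟨⟨a', b'⟩, h'⟩ e
  simpa [DiEdge.map] using e

theorem UEdge.map_injective {n : ℕ} (σ : Equiv.Perm (Fin n)) :
    Function.Injective (UEdge.map σ) := fun _ _ h =>
  Subtype.ext (Sym2.map.injective σ.injective (congrArg Subtype.val h))

theorem isMonotoneDigraphProperty_majorityDigraph {n : ℕ} (hn : 2 < n) :
    IsMonotoneDigraphProperty (majorityDigraph n) where
  invariant σ x := by
    rw [majorityDigraph, card_filter_comp_of_injective x (DiEdge.map_injective σ)]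
    rfl
  monotone := monotone_decide_lt_two_mul_card _
  nonconstant := by
    refine ⟨fun _ => false, fun _ => true, ?_⟩
    have : 0 < n * (n - 1) := Nat.mul_pos (by omega) (by omega)
    simp [majorityDigraph, -Fintype.card_subtype_compl, DiEdge.card, this]

theorem isMonotoneGraphProperty_majorityGraph {n : ℕ} (hn : 2 < n) :
    IsMonotoneGraphProperty (majorityGraph n) where
  invariant σ x := by
    rw [majorityGraph, card_filter_comp_of_injective x (UEdge.map_injective σ)]
    rfl
  monotone := monotone_decide_lt_two_mul_card _
  nonconstant := by
    refine ⟨fun _ => false, fun _ => true, ?_⟩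
    have : 0 < n.choose 2 := Nat.choose_pos hn.le
    simp [majorityGraph, -Fintype.card_subtype_compl, UEdge.card, this]

theorem mainTheorem10 :
    -- directed graphs: the lower bound `Q_E(P) = Ω(n²)` for all `P`
    (∃ c : ℝ, 0 < c ∧ ∀ (n : ℕ) (P : (DiEdge n → Bool) → Bool), IsMonotoneDigraphProperty P →
      ENNReal.ofReal (c * (n : ℝ) ^ 2) ≤ (exactQuantumQueryComplexity P : ℝ≥0∞)) ∧
    -- directed graphs: the majority property needs fewer than `n(n-1)` queries
    (∀ n : ℕ, 2 < n → IsMonotoneDigraphProperty (majorityDigraph n) ∧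
      exactQuantumQueryComplexity (majorityDigraph n) < ((n * (n - 1) : ℕ) : ℕ∞)) ∧
    -- the same for undirected graphs, which have `n(n-1)/2` possible edges
    (∃ c : ℝ, 0 < c ∧ ∀ (n : ℕ) (P : (UEdge n → Bool) → Bool), IsMonotoneGraphProperty P →
      ENNReal.ofReal (c * (n : ℝ) ^ 2) ≤ (exactQuantumQueryComplexity P : ℝ≥0∞)) ∧
    (∀ n : ℕ, 2 < n → IsMonotoneGraphProperty (majorityGraph n) ∧
      exactQuantumQueryComplexity (majorityGraph n) < ((n.choose 2 : ℕ) : ℕ∞)) := by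
  refine ⟨⟨1 / 32, by norm_num, fun n P hP => ?_⟩, fun n hn => ⟨?_, ?_⟩,
    ⟨1 / 32, by norm_num, fun n P hP => ?_⟩, fun n hn => ⟨?_, ?_⟩⟩
  · exact le_exactQuantumQueryComplexity fun T A hA => hP.sq_lt hA
  · exact isMonotoneDigraphProperty_majorityDigraph hn
  · have hne : Nonempty (DiEdge n) := Fintype.card_pos_iff.1 (by
      rw [DiEdge.card]; exact Nat.mul_pos (by omega) (by omega))
    have h := exactQuantumQueryComplexity_majority_lt (I := DiEdge n)
      (by rw [DiEdge.card]; exact Nat.mul_sub_one_ne_two_pow hn)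
    rw [DiEdge.card] at h
    exact h
  · exact le_exactQuantumQueryComplexity fun T A hA => hP.sq_lt hA
  · exact isMonotoneGraphProperty_majorityGraph hn
  · have hne : Nonempty (UEdge n) := Fintype.card_pos_iff.1 (by
      rw [UEdge.card]; exact Nat.choose_pos hn.le)
    have h := exactQuantumQueryComplexity_majority_lt (I := UEdge n)
      (by rw [UEdge.card]; exact Nat.choose_two_ne_two_pow hn)
    rw [UEdge.card] at h
    exact h
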